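/- All manifolds and maps are $C^\infty$. For a map $f:M\to B$ let $\mathrm{Crit}(f)$ be the set of points where $df$ is not surjective. A \emph{Lagrangian fibration} $f:(M^{2n},\omega)\to B^n$ is a proper map with connected (nonempty) fibres, from a connected symplectic manifold to a connected manifold, whose fibres are Lagrangian at all points outside $\mathrm{Crit}(f)$. It is \emph{admissible} if $\mathrm{Crit}(f)\cap f^{-1}(b)$ and $f^{-1}(b)\setminus \mathrm{Crit}(f)$ are connected for every $b\in B$, the discriminant locus $f(\mathrm{Crit}(f))$ is closed of codimension two, $f(M\setminus\mathrm{Crit}(f))=B$, and through each point outside $\mathrm{Crit}(f)$ there is a local smooth section of $f$. Subsets of manifolds are called diffeomorphic if there is a bijection between them which, in both directions, is locally the restriction of a smooth map of the ambient manifolds. Let $I_1$ be the pinched torus, i.e. the two-sphere immersed in $\mathbb R^4$ by $(x,y,z)\mapsto(x,y,xz,yz)$, $x^2+y^2+z^2=1$, with exactly one, transverse, double point. Let $q=(q_1,q_2)$ on $\mathbb R^4$ with coordinates $(x_1,x_2,y_1,y_2)$ and symplectic form $dx_1\wedge dy_1+dx_2\wedge dy_2$, where $q_1=x_1y_1+x_2y_2$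 and $q_2=x_1y_2-x_2y_1$. Let $D\subset\mathbb C$ be an open disc centred at $0$. A \emph{focus-focus $T^2$-fibration} $\bar f:(\bar X,\bar\omega)\to D$ is an admissible Lagrangian fibration of a $4$-manifold such that: its fibres over $D\setminus\{0\}$ are diffeomorphic to $T^2$; its fibre over $0$ is diffeomorphic to $I_1$; $\mathrm{Crit}(\bar f)$ is a single point $x_0$, with $\bar f(x_0)=0$; and near $x_0$ there are a symplectic chart $\psi$ into $\mathbb R^4$ with $\psi(x_0)=0$ and a diffeomorphism $\phi$ between open subsets of $D$ and $\mathbb C$ with $\phi\circ\bar f=q\circ\psi$. An admissible Lagrangian fibration $f:(X^6,\omega)\to B^3$ with regular fibres diffeomorphic to $T^3$ is \emph{of type $(2,2)$ over an open set $B'\subset B$} if there are an open neighbourhood $U$ of $\mathrm{Crit}(f)\cap f^{-1}(B')$ with $f(U)=B'$, a symplectomorphism $\psi$ from $U$ onto $D^4\times S^1\times(0,1)$ and a diffeomorphism $\phi$ from $B'$ onto $q(D^4)\times(0,1)$ such that $\phi\circ f=(q_1,q_2,r)\circ\psi$ on $U$. Here $D^4\subset\mathbb R^4$ is the open ball of some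 radius $R>0$ about $0$ (so that $q(D^4)$ is the open disc of radius $R^2/2$), and $D^4\times S^1\times(0,1)$, with coordinate $r$ on $(0,1)$ and angle $\theta$ on $S^1$, carries the symplectic form $dx_1\wedge dy_1+dx_2\wedge dy_2+dr\wedge d\theta$. \textbf{Proposition.} Let $\bar f:(\bar X,\bar\omega)\to D$ be a focus-focus $T^2$-fibration. Put $X=\bar X\times S^1\times(0,1)$, with angle $\theta$ on $S^1$ and coordinate $r$ on $(0,1)$, and $\omega=\bar\omega+dr\wedge d\theta$, and define $f:X\to D\times(0,1)$ by $f(p,\theta,r)=(\bar f(p),r)$. Then $\omega$ is a symplectic form on $X$ and $f$ is a Lagrangian fibration. Its discriminant locus is $\Delta=\{0\}\times(0,1)$, the fibres outside $\Delta$ are diffeomorphic to $T^3$, and the fibres over $\Delta$ are diffeomorphic to $I_1\times S^1$. Moreover, there is an open neighbourhood $D'$ of $0$ in $D$ such that $f$ is of type $(2,2)$ over $D'\times(0,1)$; that is, over $D'\times(0,1)$ it gives an element of $\mathcal L(2,2)$. -/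

import Mathlib

open Set Topology
open scoped Manifold ContDiff

noncomputable section

/-! ### Smooth two-forms and symplectic forms on manifolds -/

/-- The wedge product `α ∧ β` of two covectors. -/
def wedge {V : Type*} [AddCommGroup V] [Module ℝ V] [TopologicalSpace V]
    (α β : V →L[ℝ] ℝ) : V [⋀^Fin 2]→L[ℝ] ℝ :=
  ContinuousMultilinearMap.alternatization
    ((ContinuousMultilinearMap.mkPiAlgebra ℝ (Fin 2) ℝ).compContinuousLinearMap ![α, β])

theorem wedge_apply {V : Type*} [AddCommGroup V] [Module ℝ V] [TopologicalSpace V]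
    (α β : V →L[ℝ] ℝ) (v w : V) :
    wedge α β ![v, w] = α v * β w - α w * β v := by
  have h : (Finset.univ : Finset (Equiv.Perm (Fin 2))) = {1, Equiv.swap 0 1} := by decide
  have h' : (1 : Equiv.Perm (Fin 2)) ≠ Equiv.swap 0 1 := by decide
  simp [wedge, ContinuousMultilinearMap.alternatization_apply_apply, h, Finset.sum_pair h',
    sub_eq_add_neg]

section Manifolds

variable {E : Type*} [NormedAddCommGroup E] [NormedSpace ℝ E] {H : Type*} [TopologicalSpace H]
  {I : ModelWithCorners ℝ E H} {M : Type*} [TopologicalSpace M] [ChartedSpace H M]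
  {F : Type*} [NormedAddCommGroup F] [NormedSpace ℝ F] {G : Type*} [TopologicalSpace G]
  {J : ModelWithCorners ℝ F G} {B : Type*} [TopologicalSpace B] [ChartedSpace G B]

variable (I M) in
/-- A (not necessarily smooth) two-form: an alternating bilinear form on each tangent space. -/
abbrev TwoForm : Type _ := ∀ x : M, (TangentSpace I x) [⋀^Fin 2]→L[ℝ] ℝ

/-- The expression of a two-form in the preferred chart at `c`, i.e. its pullback under the
inverse of the chart. Only its values on the target of the chart are meaningful. -/
def chartForm (η : TwoForm I M) (c : M) (y : E) : E [⋀^Fin 2]→L[ℝ] ℝ :=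
  (η ((extChartAt I c).symm y)).compContinuousLinearMap
    (mfderiv 𝓘(ℝ, E) I (extChartAt I c).symm y)

/-- A symplectic form on a manifold without boundary: a smooth, closed, nondegenerate two-form.
Smoothness and closedness are expressed in charts. -/
structure IsSymplecticForm [I.Boundaryless] (η : TwoForm I M) : Prop where
  smooth : ∀ c : M, ContDiffOn ℝ ∞ (chartForm η c) (extChartAt I c).target
  closed : ∀ c : M, ∀ y ∈ (extChartAt I c).target, extDeriv (chartForm η c) y = 0
  nondegenerate : ∀ (x : M) (v : TangentSpace I x), (∀ w, η x ![v, w] = 0) → v = 0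

/-! ### Smooth maps between subsets, partial diffeomorphisms -/

variable (I J) in
/-- A map `g : A → B` between arbitrary subsets of manifolds is smooth if near every point of `A`
it is the restriction of a smooth map between the ambient manifolds. -/
def IsSmoothBetween {A : Set M} {C : Set B} (g : A → C) : Prop :=
  ∀ a : A, ∃ U : Set M, IsOpen U ∧ (a : M) ∈ U ∧ ∃ g' : M → B,
    ContMDiffOn I J ∞ g' U ∧ ∀ x : A, (x : M) ∈ U → g' x = g x

variable (I J) in
/-- Subsets `A`, `C` of manifolds are diffeomorphic: there is a bijection between them that is
smooth in both directions. -/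
def AreDiffeomorphic (A : Set M) (C : Set B) : Prop :=
  ∃ e : A ≃ C, IsSmoothBetween I J e ∧ IsSmoothBetween J I e.symm

variable (I J) in
/-- A homeomorphism between open subsets of two manifolds is a diffeomorphism. -/
def IsDiffeoOn (e : OpenPartialHomeomorph M B) : Prop :=
  ContMDiffOn I J ∞ e e.source ∧ ContMDiffOn J I ∞ e.symm e.target

/-- `e` is a symplectomorphism between its source and its target. -/
def IsSymplectoOn (η : TwoForm I M) (ζ : TwoForm J B) (e : OpenPartialHomeomorph M B) : Prop :=
  IsDiffeoOn I J e ∧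
    ∀ x ∈ e.source, η x = (ζ (e x)).compContinuousLinearMap (mfderiv I J e x)

/-! ### Lagrangian fibrations -/

variable (I J) in
/-- The set of points at which the differential of `f` is not surjective. -/
def Crit (f : M → B) : Set M := {x | ¬ Function.Surjective (mfderiv I J f x)}

variable (J) in
/-- `f : (M, η) → B` is a Lagrangian fibration: `(M, η)` is a connected symplectic manifold of
dimension `2 n`, `B` is connected of dimension `n`, and `f` is a proper smooth map with connected
(nonempty) fibres, such that at each regular point the tangent space of the fibre, `ker df`, is a
Lagrangian subspace, i.e. it equals its own `η`-orthogonal. -/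
structure IsLagrangianFibration [I.Boundaryless] (η : TwoForm I M) (f : M → B) : Prop where
  finrank_pos : 0 < Module.finrank ℝ F
  finrank_eq : Module.finrank ℝ E = 2 * Module.finrank ℝ F
  connected_total : ConnectedSpace M
  connected_base : ConnectedSpace B
  symplectic : IsSymplecticForm η
  smooth : ContMDiff I J ∞ f
  proper : IsProperMap f
  connected_fibre : ∀ b : B, IsConnected (f ⁻¹' {b})
  lagrangian : ∀ x ∉ Crit I J f, ∀ v : TangentSpace I x,
    mfderiv I J f x v = 0 ↔ ∀ w : TangentSpace I x, mfderiv I J f x w = 0 → η x ![v, w] = 0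

variable (J) in
/-- A subset of a manifold has codimension two: its Hausdorff dimension, computed in the charts,
is the dimension of the manifold minus two. -/
def HasCodimTwo (S : Set B) : Prop :=
  (⨆ c : B, dimH (extChartAt J c '' (S ∩ (extChartAt J c).source))) + 2 = Module.finrank ℝ F

variable (I J) in
/-- Admissibility of a fibration `f`: the critical set of each fibre and the regular part of each
fibre are connected, the discriminant locus is closed of codimension two, and the regular part
of `M` maps onto `B`, with a local smooth section of `f` through each of its points. -/
structure IsAdmissible (f : M → B) : Prop where
  crit_connected : ∀ b : B, IsPreconnected (Crit I J f ∩ f ⁻¹' {b})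
  regular_connected : ∀ b : B, IsPreconnected ((Crit I J f)ᶜ ∩ f ⁻¹' {b})
  discriminant_closed : IsClosed (f '' Crit I J f)
  discriminant_codim : HasCodimTwo J (f '' Crit I J f)
  regular_surjective : f '' (Crit I J f)ᶜ = univ
  exists_section : ∀ x ∉ Crit I J f, ∃ (W : Set B) (σ : B → M), IsOpen W ∧ f x ∈ W ∧
    ContMDiffOn J I ∞ σ W ∧ (∀ b ∈ W, f (σ b) = b) ∧ σ (f x) = x

end Manifolds

/-! ### Focus-focus fibrations in dimension four -/

/-- The open disc of radius `ρ` about `0` in `ℂ`, as a manifold. -/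
def disc (ρ : ℝ) : TopologicalSpace.Opens ℂ := ⟨Metric.ball 0 ρ, Metric.isOpen_ball⟩

/-- The form `dx₁ ∧ dy₁ + dx₂ ∧ dy₂` on `ℝ⁴` with coordinates `(x₁, x₂, y₁, y₂)`. -/
def stdForm : TwoForm (𝓡 4) (EuclideanSpace ℝ (Fin 4)) := fun _ =>
  (wedge (EuclideanSpace.proj 0 : EuclideanSpace ℝ (Fin 4) →L[ℝ] ℝ) (EuclideanSpace.proj 2) +
    wedge (EuclideanSpace.proj 1 : EuclideanSpace ℝ (Fin 4) →L[ℝ] ℝ) (EuclideanSpace.proj 3) :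
      EuclideanSpace ℝ (Fin 4) [⋀^Fin 2]→L[ℝ] ℝ)

/-- The focus-focus normal form `q₁ + i q₂`, where `q₁ = x₁ y₁ + x₂ y₂` and
`q₂ = x₁ y₂ - x₂ y₁`. -/
def focusFocus (v : EuclideanSpace ℝ (Fin 4)) : ℂ :=
  ⟨v 0 * v 2 + v 1 * v 3, v 0 * v 3 - v 1 * v 2⟩

/-- The pinched torus `I₁`: a two-sphere immersed in `ℝ⁴` with exactly one double point, at which
the two branches are transverse. It is the image of the unit sphere under
`(x, y, z) ↦ (x, y, x z, y z)`, which identifies the two poles and is otherwise injective. -/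
def pinchedTorus : Set (EuclideanSpace ℝ (Fin 4)) :=
  {p | ∃ x y z : ℝ, x ^ 2 + y ^ 2 + z ^ 2 = 1 ∧ p = !₂[x, y, x * z, y * z]}

/-- A focus-focus `T²`-fibration over the disc of radius `ρ`: an admissible Lagrangian fibration
with `T²` as regular fibre and exactly one singular fibre, over the centre; this fibre is of
type `I₁`, and its unique singular point is of focus-focus type. -/
structure IsFocusFocusFibration {Y : Type*} [TopologicalSpace Y]
    [ChartedSpace (EuclideanSpace ℝ (Fin 4)) Y] {ρ : ℝ}
    (η : TwoForm (𝓡 4) Y) (g : Y → disc ρ) : Prop where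
  lagrangian : IsLagrangianFibration 𝓘(ℝ, ℂ) η g
  admissible : IsAdmissible (𝓡 4) 𝓘(ℝ, ℂ) g
  regular_fibre : ∀ b : disc ρ, (b : ℂ) ≠ 0 →
    AreDiffeomorphic (𝓡 4) ((𝓡 1).prod (𝓡 1)) (g ⁻¹' {b}) (univ : Set (Circle × Circle))
  singular_fibre : ∀ b : disc ρ, (b : ℂ) = 0 →
    AreDiffeomorphic (𝓡 4) (𝓡 4) (g ⁻¹' {b}) pinchedTorus
  normal_form : ∃ x₀ : Y, Crit (𝓡 4) 𝓘(ℝ, ℂ) g = {x₀} ∧ (g x₀ : ℂ) = 0 ∧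
    ∃ (ψ : OpenPartialHomeomorph Y (EuclideanSpace ℝ (Fin 4)))
      (φ : OpenPartialHomeomorph (disc ρ) ℂ),
      x₀ ∈ ψ.source ∧ ψ x₀ = 0 ∧ MapsTo g ψ.source φ.source ∧
      IsSymplectoOn η stdForm ψ ∧ IsDiffeoOn 𝓘(ℝ, ℂ) 𝓘(ℝ, ℂ) φ ∧
      ∀ x ∈ ψ.source, φ (g x) = focusFocus (ψ x)

/-! ### The product with `S¹ × (0, 1)` -/

/-- The open interval `(0, 1)`, as a manifold. -/
def unitIoo : TopologicalSpace.Opens ℝ := ⟨Ioo 0 1, isOpen_Ioo⟩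

/-- The angular form `dθ` on the unit circle (of total integral `2π`): `v ↦ Im (z̄ v)` for `v`
tangent to the circle at `z`. -/
def dθ (z : Circle) : TangentSpace (𝓡 1) z →L[ℝ] ℝ :=
  (Complex.imCLM.comp (ContinuousLinearMap.mul ℝ ℂ ((starRingEnd ℂ) (z : ℂ)))).comp
    (mfderiv (𝓡 1) 𝓘(ℝ, ℂ) (fun w : Circle => (w : ℂ)) z)

/-- The form `dr` on `(0, 1)`. -/
def dr (r : unitIoo) : TangentSpace 𝓘(ℝ, ℝ) r →L[ℝ] ℝ :=
  mfderiv 𝓘(ℝ, ℝ) 𝓘(ℝ, ℝ) (fun s : unitIoo => (s : ℝ)) r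

/-- The model with corners of `Y × S¹ × (0, 1)` for a four-manifold `Y`. -/
abbrev model6 := (𝓡 4).prod ((𝓡 1).prod 𝓘(ℝ, ℝ))

/-- The model with corners of `D × (0, 1)` for a surface `D` modelled on `ℂ`. -/
abbrev model3 := (𝓘(ℝ, ℂ)).prod 𝓘(ℝ, ℝ)

/-- The two-form `η + dr ∧ dθ` (pulled back from the factors) on `Y × S¹ × (0, 1)`. -/
def prodForm {Y : Type*} [TopologicalSpace Y] [ChartedSpace (EuclideanSpace ℝ (Fin 4)) Y]
    (η : TwoForm (𝓡 4) Y) : TwoForm model6 (Y × Circle × unitIoo) := fun x =>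
  (η x.1).compContinuousLinearMap
      (mfderiv model6 (𝓡 4) (fun y : Y × Circle × unitIoo => y.1) x) +
    wedge
      ((dr x.2.2).comp (mfderiv model6 𝓘(ℝ, ℝ) (fun y : Y × Circle × unitIoo => y.2.2) x))
      ((dθ x.2.1).comp (mfderiv model6 (𝓡 1) (fun y : Y × Circle × unitIoo => y.2.1) x))

/-- The map `(p, z, r) ↦ (g p, r)`. -/
def prodMap {Y D : Type*} (g : Y → D) (x : Y × Circle × unitIoo) : D × unitIoo := (g x.1, x.2.2)

section TypeTwoTwo

variable {E : Type*} [NormedAddCommGroup E] [NormedSpace ℝ E] {H : Type*} [TopologicalSpace H]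
  {I : ModelWithCorners ℝ E H} {M : Type*} [TopologicalSpace M] [ChartedSpace H M]
  {F : Type*} [NormedAddCommGroup F] [NormedSpace ℝ F] {G : Type*} [TopologicalSpace G]
  {B : Type*} [TopologicalSpace B] [ChartedSpace G B]

/-- `f : (M, η) → B`, restricted to the part of `M` over the open set `B' ⊆ B`, is a Lagrangian
fibration of type `(2, 2)`: `f` is an admissible Lagrangian `T³`-fibration and there are an open
neighbourhood `U` of the critical set over `B'`, with `f(U) = B'`, a symplectomorphism `ψ` from `U`
onto `D⁴ × S¹ × (0, 1)` and a diffeomorphism `φ` from `B'` onto `D² × (0, 1)` that transform `f`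
into `(q₁, q₂, r)` with `q₁, q₂` of focus-focus type. Here `D⁴` is the open ball of some radius
`R`, and `D²` is its image under `(q₁, q₂)`, the open disc of radius `R² / 2`. -/
structure IsTypeTwoTwoOver (J : ModelWithCorners ℝ F G) [I.Boundaryless] (η : TwoForm I M)
    (f : M → B) (B' : Set B) : Prop where
  lagrangian : IsLagrangianFibration J η f
  admissible : IsAdmissible I J f
  regular_fibre : ∀ b : B, b ∉ f '' Crit I J f →
    AreDiffeomorphic I ((𝓡 1).prod ((𝓡 1).prod (𝓡 1))) (f ⁻¹' {b})
      (univ : Set (Circle × Circle × Circle))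
  normal_form : ∃ (R : ℝ)
    (ψ : OpenPartialHomeomorph M (EuclideanSpace ℝ (Fin 4) × Circle × unitIoo))
    (φ : OpenPartialHomeomorph B (ℂ × unitIoo)), 0 < R ∧
      Crit I J f ∩ f ⁻¹' B' ⊆ ψ.source ∧ f '' ψ.source = B' ∧ φ.source = B' ∧
      ψ.target = Metric.ball 0 R ×ˢ univ ∧ φ.target = Metric.ball 0 (R ^ 2 / 2) ×ˢ univ ∧
      IsSymplectoOn η (prodForm stdForm) ψ ∧ IsDiffeoOn J model3 φ ∧
      ∀ x ∈ ψ.source, φ (f x) = prodMap focusFocus (ψ x)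

end TypeTwoTwo

end

/-! ### The forms `dr` and `dθ` -/

/-! Everything splits along the product. On `TY ⊕ TS¹ ⊕ T(0,1)` the differential of `f` is `dg` on
the first summand, zero on the second and the identity onto the `r`-direction on the third
(`mfderiv_prodMap_apply`). Hence `Crit f = Crit g × S¹ × (0,1)`, and a fibre of `f` is a fibre of
`g` times `S¹ × {r}`; connectedness, local sections and the diffeomorphism types of fibres are
obtained factor by factor, and properness because `S¹` is compact.

The form is the block sum of `η` and `dr ∧ dθ` (`prodForm_apply`). In a product chart each block is
pulled back from one factor (`chartForm_prodForm`); the second is closed because it has top degree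
on a surface, and nondegenerate because `dθ` vanishes nowhere. At regular points `ker df = ker dg ⊕
TS¹`: `dr` vanishes on it, and a vector orthogonal to `TS¹` has no `r`-component, so it is
Lagrangian as soon as `ker dg` is.

Only type `(2, 2)` needs a choice of neighbourhoods. With `z₁ = x₁ + i x₂` and `z₂ = y₁ + i y₂` the
normal form is `q = z̄₁ z₂`, which maps the ball of radius `R` onto the disc of radius `R² / 2`
(`focusFocus_image_ball`). A ball inside the image of the focus-focus chart therefore determines
`D'`, and both charts, so restricted, are multiplied by identities. -/

theorem hasMFDerivAt_unitIoo_val (r : unitIoo) :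
    HasMFDerivAt 𝓘(ℝ, ℝ) 𝓘(ℝ, ℝ) (fun s : unitIoo => (s : ℝ)) r
      (ContinuousLinearMap.id ℝ ℝ) := by
  refine ⟨continuous_subtype_val.continuousAt, ?_⟩
  have hr : (extChartAt 𝓘(ℝ, ℝ) r) r ∈ (extChartAt 𝓘(ℝ, ℝ) r).target := mem_extChartAt_target r
  have : writtenInExtChartAt 𝓘(ℝ, ℝ) 𝓘(ℝ, ℝ) r (fun s : unitIoo => (s : ℝ))
      =ᶠ[𝓝 ((extChartAt 𝓘(ℝ, ℝ) r) r)] id := by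
    filter_upwards [(isOpen_extChartAt_target r).mem_nhds hr] with y hy
    exact (extChartAt 𝓘(ℝ, ℝ) r).right_inv hy
  exact ((hasFDerivAt_id _).congr_of_eventuallyEq this).hasFDerivWithinAt

theorem dr_apply (r : unitIoo) (v : ℝ) : dr r v = v := by
  have := (hasMFDerivAt_unitIoo_val r).mfderiv
  exact congrArg (fun L : ℝ →L[ℝ] ℝ => L v) this

theorem contMDiff_circle_coe : ContMDiff (𝓡 1) 𝓘(ℝ, ℂ) ∞ (fun w : Circle => (w : ℂ)) :=
  have := finrank_real_complex_fact'
  contMDiff_coe_sphere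

/-- The inclusion of the circle in `ℂ` is an immersion whose tangent line at `z` is the real
orthogonal complement of `z`. A tangent vector `u` thus satisfies `Re (z̄ u) = 0`; if also `Im (z̄
u) = 0`, then `z̄ u = 0`, and `z̄ ≠ 0`. -/
theorem dθ_injective (z : Circle) : Function.Injective (dθ z) := by
  have := finrank_real_complex_fact'
  rw [injective_iff_map_eq_zero]
  intro v hv
  have hinj : Function.Injective (mfderiv (𝓡 1) 𝓘(ℝ, ℂ) (fun w : Circle => (w : ℂ)) z) :=
    injective_mvfderiv_subtypeVal_sphere (E := ℂ) (n := 1) z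
  obtain ⟨u, hu⟩ : ∃ u : ℂ, u = mfderiv (𝓡 1) 𝓘(ℝ, ℂ) (fun w : Circle => (w : ℂ)) z v := ⟨_, rfl⟩
  have hu' : u ∈ (Submodule.span ℝ {(z : ℂ)})ᗮ := by
    have := range_mvfderiv_subtypeVal (E := ℂ) (n := 1) z
    exact this ▸ ⟨v, hu.symm⟩
  have hre : ((starRingEnd ℂ) (z : ℂ) * u).re = 0 := by
    rw [Submodule.mem_orthogonal_singleton_iff_inner_right, Complex.inner] at hu'
    rwa [mul_comm]
  have him : ((starRingEnd ℂ) (z : ℂ) * u).im = 0 := by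
    rw [hu]; exact hv
  have h0 : u = 0 := (mul_eq_zero.1 (Complex.ext hre him)).resolve_left (by simp)
  exact hinj ((hu.symm.trans h0).trans (map_zero _).symm)

theorem exists_dθ_ne_zero (z : Circle) : ∃ v : EuclideanSpace ℝ (Fin 1), dθ z v ≠ 0 := by
  refine ⟨EuclideanSpace.single 0 1, fun h => ?_⟩
  have := dθ_injective z (h.trans (map_zero (dθ z)).symm)
  have h2 : (EuclideanSpace.single 0 1 : EuclideanSpace ℝ (Fin 1)) 0 = 0 :=
    congrArg (fun v : EuclideanSpace ℝ (Fin 1) => v 0) this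
  simp at h2

/-! ### The form `η + dr ∧ dθ` -/

section

variable {Y : Type*} [TopologicalSpace Y] [ChartedSpace (EuclideanSpace ℝ (Fin 4)) Y]

theorem mfderiv_proj_first (x : Y × Circle × unitIoo)
    (v : EuclideanSpace ℝ (Fin 4) × EuclideanSpace ℝ (Fin 1) × ℝ) :
    mfderiv model6 (𝓡 4) (fun y : Y × Circle × unitIoo => y.1) x v = v.1 := by
  have : mfderiv model6 (𝓡 4) (Prod.fst : Y × Circle × unitIoo → Y) x = _ := mfderiv_fst
  exact DFunLike.congr_fun this v

theorem mfderiv_proj_circle (x : Y × Circle × unitIoo)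
    (v : EuclideanSpace ℝ (Fin 4) × EuclideanSpace ℝ (Fin 1) × ℝ) :
    mfderiv model6 (𝓡 1) (fun y : Y × Circle × unitIoo => y.2.1) x v = v.2.1 := by
  have h1 := (hasMFDerivAt_snd (I := 𝓡 4) (I' := (𝓡 1).prod 𝓘(ℝ, ℝ)) x)
  have h2 := (hasMFDerivAt_fst (I := 𝓡 1) (I' := 𝓘(ℝ, ℝ)) x.2)
  have := (h2.comp x h1).mfderiv
  exact DFunLike.congr_fun this v

theorem mfderiv_proj_interval (x : Y × Circle × unitIoo)
    (v : EuclideanSpace ℝ (Fin 4) × EuclideanSpace ℝ (Fin 1) × ℝ) :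
    mfderiv model6 𝓘(ℝ, ℝ) (fun y : Y × Circle × unitIoo => y.2.2) x v = v.2.2 := by
  have h1 := (hasMFDerivAt_snd (I := 𝓡 4) (I' := (𝓡 1).prod 𝓘(ℝ, ℝ)) x)
  have h2 := (hasMFDerivAt_snd (I := 𝓡 1) (I' := 𝓘(ℝ, ℝ)) x.2)
  have := (h2.comp x h1).mfderiv
  exact DFunLike.congr_fun this v

theorem matrix_fin_two_comp {V W : Type*} (L : V → W) (v w : V) : L ∘ ![v, w] = ![L v, L w] := by
  funext i; fin_cases i <;> rfl

theorem compContinuousLinearMap_add_wedge_apply {V W : Type*} [AddCommGroup V] [Module ℝ V]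
    [TopologicalSpace V] [AddCommGroup W] [Module ℝ W] [TopologicalSpace W]
    (A : W [⋀^Fin 2]→L[ℝ] ℝ) (L : V →L[ℝ] W) (α β : V →L[ℝ] ℝ) (v w : V) :
    (A.compContinuousLinearMap L + wedge α β) ![v, w] =
      A ![L v, L w] + (α v * β w - α w * β v) := by
  rw [ContinuousAlternatingMap.add_apply, wedge_apply,
    ContinuousAlternatingMap.compContinuousLinearMap_apply, matrix_fin_two_comp]

theorem prodForm_apply (η : TwoForm (𝓡 4) Y) (x : Y × Circle × unitIoo)
    (v w : EuclideanSpace ℝ (Fin 4) × EuclideanSpace ℝ (Fin 1) × ℝ) :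
    prodForm η x ![v, w] =
      η x.1 ![v.1, w.1] + (v.2.2 * dθ x.2.1 w.2.1 - w.2.2 * dθ x.2.1 v.2.1) := by
  -- The components are turned back into values of the differentials of the projections, so that the
  -- right side takes the shape in which `prodForm` is defined.
  rw [← mfderiv_proj_first x v, ← mfderiv_proj_first x w, ← mfderiv_proj_circle x v,
    ← mfderiv_proj_circle x w, ← mfderiv_proj_interval x v, ← mfderiv_proj_interval x w,
    ← dr_apply x.2.2 (mfderiv model6 𝓘(ℝ, ℝ) (fun y : Y × Circle × unitIoo => y.2.2) x v),
    ← dr_apply x.2.2 (mfderiv model6 𝓘(ℝ, ℝ) (fun y : Y × Circle × unitIoo => y.2.2) x w)]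
  exact compContinuousLinearMap_add_wedge_apply (V := TangentSpace model6 x)
    (W := TangentSpace (𝓡 4) x.1) (η x.1) _ _ _ v w

end

/-! ### Closed forms under linear pullback -/

section

variable {E F : Type*} [NormedAddCommGroup E] [NormedSpace ℝ E] [NormedAddCommGroup F]
  [NormedSpace ℝ F]

theorem extDeriv_linear_pullback {n : ℕ} {α : F → F [⋀^Fin n]→L[ℝ] ℝ} (L : E →L[ℝ] F) {x : E}
    (hα : DifferentiableAt ℝ α (L x)) :
    extDeriv (fun y => (α (L y)).compContinuousLinearMap L) x =
      (extDeriv α (L x)).compContinuousLinearMap L := by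
  have := extDeriv_pullback (r := ⊤) hα L.contDiff.contDiffAt (by simp)
  simpa using this

theorem ContDiffOn.linear_pullback {n : ℕ} {α : F → F [⋀^Fin n]→L[ℝ] ℝ} (L : E →L[ℝ] F)
    {s : Set F} {t : Set E} (hα : ContDiffOn ℝ ∞ α s) (hst : MapsTo L t s) :
    ContDiffOn ℝ ∞ (fun y => (α (L y)).compContinuousLinearMap L) t :=
  (ContinuousAlternatingMap.compContinuousLinearMapCLM (𝕜 := ℝ) (F := ℝ) (ι := Fin n)
    L).contDiff.comp_contDiffOn (hα.comp L.contDiff.contDiffOn hst)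

/-- The derivative is an `(n + 1)`-form, and any `n + 1` vectors are dependent. This makes `dr ∧ dθ`
closed in coordinates without differentiating `circleDensity`. -/
theorem extDeriv_eq_zero_of_finrank_le [FiniteDimensional ℝ E] {n : ℕ}
    (hn : Module.finrank ℝ E ≤ n) (α : E → E [⋀^Fin n]→L[ℝ] ℝ) (x : E) : extDeriv α x = 0 := by
  ext v
  refine AlternatingMap.map_linearDependent (extDeriv α x).toAlternatingMap v fun h => ?_
  have := h.fintype_card_le_finrank
  simp at this
  omega

end

/-! ### The coordinate expression of `η + dr ∧ dθ` -/

/-- Near `y`, the inclusion into `ℝ` composed with the inverse chart is the identity, and the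
inclusion itself has identity derivative. -/
theorem mfderiv_extChartAt_symm_unitIoo (r : unitIoo) {y : ℝ}
    (hy : y ∈ (extChartAt 𝓘(ℝ, ℝ) r).target) (v : ℝ) :
    mfderiv 𝓘(ℝ, ℝ) 𝓘(ℝ, ℝ) (extChartAt 𝓘(ℝ, ℝ) r).symm y v = v := by
  have h1 := hasMFDerivAt_unitIoo_val ((extChartAt 𝓘(ℝ, ℝ) r).symm y)
  have hd : MDifferentiableAt 𝓘(ℝ, ℝ) 𝓘(ℝ, ℝ) (extChartAt 𝓘(ℝ, ℝ) r).symm y :=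
    ((contMDiffOn_extChartAt_symm (n := ∞) r).contMDiffAt
      ((isOpen_extChartAt_target r).mem_nhds hy)).mdifferentiableAt (by simp)
  have h2 := (h1.comp y hd.hasMFDerivAt).mfderiv
  have h3 : mfderiv 𝓘(ℝ, ℝ) 𝓘(ℝ, ℝ)
      ((fun s : unitIoo => (s : ℝ)) ∘ (extChartAt 𝓘(ℝ, ℝ) r).symm) y =
      mfderiv 𝓘(ℝ, ℝ) 𝓘(ℝ, ℝ) (id : ℝ → ℝ) y := by
    apply Filter.EventuallyEq.mfderiv_eq
    filter_upwards [(isOpen_extChartAt_target r).mem_nhds hy] with z hz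
    exact (extChartAt 𝓘(ℝ, ℝ) r).right_inv hz
  rw [h3, mfderiv_id] at h2
  exact (DFunLike.congr_fun h2 v).symm

/-- The coordinate expression of the inclusion of the circle in the plane. -/
noncomputable def circleParam (z : Circle) (u : EuclideanSpace ℝ (Fin 1)) : ℂ :=
  ((extChartAt (𝓡 1) z).symm u : Circle)

/-- The coefficient of `dθ` in the preferred chart at `z`. -/
noncomputable def circleDensity (z : Circle) (u : EuclideanSpace ℝ (Fin 1)) : ℝ :=
  ((starRingEnd ℂ) (circleParam z u) *
    fderiv ℝ (circleParam z) u (EuclideanSpace.single 0 1)).im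

theorem contDiffOn_circleParam (z : Circle) :
    ContDiffOn ℝ ∞ (circleParam z) (extChartAt (𝓡 1) z).target :=
  contMDiffOn_iff_contDiffOn.1
    (contMDiff_circle_coe.comp_contMDiffOn (contMDiffOn_extChartAt_symm z))

theorem contDiffOn_circleDensity (z : Circle) :
    ContDiffOn ℝ ∞ (circleDensity z) (extChartAt (𝓡 1) z).target := by
  have h := contDiffOn_circleParam z
  have h' := (h.fderiv_of_isOpen (isOpen_extChartAt_target z) (m := ∞) (by simp)).clm_apply
    (contDiffOn_const (c := (EuclideanSpace.single 0 1 : EuclideanSpace ℝ (Fin 1))))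
  exact Complex.imCLM.contDiff.comp_contDiffOn
    ((Complex.conjCLE.contDiff.comp_contDiffOn h).mul h')

/-- By the chain rule, composing with the inclusion into `ℂ` replaces the inverse chart by
`circleParam`; its derivative on the one-dimensional model is determined by the value at the unit
vector. -/
theorem dθ_mfderiv_extChartAt_symm (z : Circle) {u : EuclideanSpace ℝ (Fin 1)}
    (hu : u ∈ (extChartAt (𝓡 1) z).target) (v : EuclideanSpace ℝ (Fin 1)) :
    dθ ((extChartAt (𝓡 1) z).symm u)
      (mfderiv (𝓡 1) (𝓡 1) (extChartAt (𝓡 1) z).symm u v) = circleDensity z u * v 0 := by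
  have hd : MDifferentiableAt (𝓡 1) (𝓡 1) (extChartAt (𝓡 1) z).symm u :=
    ((contMDiffOn_extChartAt_symm (n := ∞) z).contMDiffAt
      ((isOpen_extChartAt_target z).mem_nhds hu)).mdifferentiableAt (by simp)
  have hc := (contMDiff_circle_coe ((extChartAt (𝓡 1) z).symm u)).mdifferentiableAt (by simp)
  have h := (mfderiv_comp u hc hd).symm.trans mfderiv_eq_fderiv
  have hv : v = v 0 • (EuclideanSpace.single 0 1 : EuclideanSpace ℝ (Fin 1)) := by
    ext i; fin_cases i; simp
  obtain ⟨ξ, hξ⟩ : ∃ ξ : ℂ, ξ = mfderiv (𝓡 1) 𝓘(ℝ, ℂ) (fun w : Circle => (w : ℂ))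
      ((extChartAt (𝓡 1) z).symm u) (mfderiv (𝓡 1) (𝓡 1) (extChartAt (𝓡 1) z).symm u v) :=
    ⟨_, rfl⟩
  have h1 : ξ = (v 0 : ℂ) * fderiv ℝ (circleParam z) u (EuclideanSpace.single 0 1) := by
    refine (hξ.trans (DFunLike.congr_fun h v)).trans ?_
    change fderiv ℝ (circleParam z) u v = _
    conv_lhs => rw [hv]
    rw [map_smul, Complex.real_smul]
  have h2 : dθ ((extChartAt (𝓡 1) z).symm u)
      (mfderiv (𝓡 1) (𝓡 1) (extChartAt (𝓡 1) z).symm u v) =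
      ((starRingEnd ℂ) (circleParam z u) * ξ).im := by rw [hξ]; rfl
  rw [h2, h1, circleDensity, mul_left_comm, Complex.im_ofReal_mul, mul_comm]

/-- The coordinate expression of `dr ∧ dθ` in the chart of the circle at `z`. -/
noncomputable def cylinderForm (z : Circle) (p : EuclideanSpace ℝ (Fin 1) × ℝ) :
    (EuclideanSpace ℝ (Fin 1) × ℝ) [⋀^Fin 2]→L[ℝ] ℝ :=
  circleDensity z p.1 • wedge (ContinuousLinearMap.snd ℝ _ ℝ)
    ((EuclideanSpace.proj 0 : EuclideanSpace ℝ (Fin 1) →L[ℝ] ℝ).comp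
      (ContinuousLinearMap.fst ℝ _ ℝ))

theorem cylinderForm_apply (z : Circle) (p v w : EuclideanSpace ℝ (Fin 1) × ℝ) :
    cylinderForm z p ![v, w] = circleDensity z p.1 * (v.2 * w.1 0 - w.2 * v.1 0) := by
  simp [cylinderForm, wedge_apply]

theorem contDiffOn_cylinderForm (z : Circle) :
    ContDiffOn ℝ ∞ (cylinderForm z) ((extChartAt (𝓡 1) z).target ×ˢ univ) :=
  ((contDiffOn_circleDensity z).comp contDiffOn_fst fun _ h => h.1).smul contDiffOn_const

section

variable {Y : Type*} [TopologicalSpace Y] [ChartedSpace (EuclideanSpace ℝ (Fin 4)) Y]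
  [IsManifold (𝓡 4) ∞ Y]

theorem mfderiv_extChartAt_symm_model6 (c : Y × Circle × unitIoo)
    {y : EuclideanSpace ℝ (Fin 4) × EuclideanSpace ℝ (Fin 1) × ℝ}
    (hy : y ∈ (extChartAt model6 c).target)
    (v : EuclideanSpace ℝ (Fin 4) × EuclideanSpace ℝ (Fin 1) × ℝ) :
    mfderiv 𝓘(ℝ, EuclideanSpace ℝ (Fin 4) × EuclideanSpace ℝ (Fin 1) × ℝ) model6
      (extChartAt model6 c).symm y v =
      (mfderiv (𝓡 4) (𝓡 4) (extChartAt (𝓡 4) c.1).symm y.1 v.1,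
        mfderiv (𝓡 1) (𝓡 1) (extChartAt (𝓡 1) c.2.1).symm y.2.1 v.2.1, v.2.2) := by
  have hy' : y.1 ∈ (extChartAt (𝓡 4) c.1).target ∧ y.2.1 ∈ (extChartAt (𝓡 1) c.2.1).target ∧
      y.2.2 ∈ (extChartAt 𝓘(ℝ, ℝ) c.2.2).target := by
    rw [extChartAt_prod, extChartAt_prod] at hy
    exact hy
  obtain ⟨hy1, hy2, hy3⟩ := hy'
  have hd1 : MDifferentiableAt (𝓡 4) (𝓡 4) (extChartAt (𝓡 4) c.1).symm y.1 :=
    ((contMDiffOn_extChartAt_symm (n := ∞) c.1).contMDiffAt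
      ((isOpen_extChartAt_target c.1).mem_nhds hy1)).mdifferentiableAt (by simp)
  have hd2 : MDifferentiableAt (𝓡 1) (𝓡 1) (extChartAt (𝓡 1) c.2.1).symm y.2.1 :=
    ((contMDiffOn_extChartAt_symm (n := ∞) c.2.1).contMDiffAt
      ((isOpen_extChartAt_target c.2.1).mem_nhds hy2)).mdifferentiableAt (by simp)
  have hd3 : MDifferentiableAt 𝓘(ℝ, ℝ) 𝓘(ℝ, ℝ) (extChartAt 𝓘(ℝ, ℝ) c.2.2).symm y.2.2 :=
    ((contMDiffOn_extChartAt_symm (n := ∞) c.2.2).contMDiffAt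
      ((isOpen_extChartAt_target c.2.2).mem_nhds hy3)).mdifferentiableAt (by simp)
  have p1 : HasMFDerivAt 𝓘(ℝ, EuclideanSpace ℝ (Fin 4) × EuclideanSpace ℝ (Fin 1) × ℝ) (𝓡 4)
      Prod.fst y _ := (hasFDerivAt_fst (𝕜 := ℝ)).hasMFDerivAt
  have p2 : HasMFDerivAt 𝓘(ℝ, EuclideanSpace ℝ (Fin 4) × EuclideanSpace ℝ (Fin 1) × ℝ) (𝓡 1)
      (fun p => p.2.1) y _ :=
    ((hasFDerivAt_fst (𝕜 := ℝ)).comp y (hasFDerivAt_snd (𝕜 := ℝ))).hasMFDerivAt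
  have p3 : HasMFDerivAt 𝓘(ℝ, EuclideanSpace ℝ (Fin 4) × EuclideanSpace ℝ (Fin 1) × ℝ) 𝓘(ℝ, ℝ)
      (fun p => p.2.2) y _ :=
    ((hasFDerivAt_snd (𝕜 := ℝ)).comp y (hasFDerivAt_snd (𝕜 := ℝ))).hasMFDerivAt
  have h := ((hd1.hasMFDerivAt.comp y p1).prodMk
    ((hd2.hasMFDerivAt.comp y p2).prodMk (hd3.hasMFDerivAt.comp y p3))).mfderiv
  have h3 := mfderiv_extChartAt_symm_unitIoo c.2.2 hy3 v.2.2
  rw [extChartAt_prod, extChartAt_prod]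
  refine (DFunLike.congr_fun h v).trans ?_
  exact congrArg (fun s : ℝ => ((mfderiv (𝓡 4) (𝓡 4) (extChartAt (𝓡 4) c.1).symm y.1 v.1,
        mfderiv (𝓡 1) (𝓡 1) (extChartAt (𝓡 1) c.2.1).symm y.2.1 v.2.1, s) :
        EuclideanSpace ℝ (Fin 4) × EuclideanSpace ℝ (Fin 1) × ℝ)) h3

/-- The inverse of a product chart acts componentwise. Writing each block as a linear pullback from
its own factor reduces smoothness and closedness to the two factors. -/
theorem chartForm_prodForm (η : TwoForm (𝓡 4) Y) (c : Y × Circle × unitIoo) :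
    EqOn (chartForm (prodForm η) c)
      (fun y => (chartForm η c.1 (ContinuousLinearMap.fst ℝ (EuclideanSpace ℝ (Fin 4))
          (EuclideanSpace ℝ (Fin 1) × ℝ) y)).compContinuousLinearMap
          (ContinuousLinearMap.fst ℝ (EuclideanSpace ℝ (Fin 4)) (EuclideanSpace ℝ (Fin 1) × ℝ)) +
        (cylinderForm c.2.1 (ContinuousLinearMap.snd ℝ (EuclideanSpace ℝ (Fin 4))
          (EuclideanSpace ℝ (Fin 1) × ℝ) y)).compContinuousLinearMap
          (ContinuousLinearMap.snd ℝ (EuclideanSpace ℝ (Fin 4)) (EuclideanSpace ℝ (Fin 1) × ℝ)))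
      (extChartAt model6 c).target := by
  intro y hy
  have hy' : y.1 ∈ (extChartAt (𝓡 4) c.1).target ∧ y.2.1 ∈ (extChartAt (𝓡 1) c.2.1).target ∧
      y.2.2 ∈ (extChartAt 𝓘(ℝ, ℝ) c.2.2).target := by
    rw [extChartAt_prod, extChartAt_prod] at hy
    exact hy
  ext m
  obtain ⟨v, w, rfl⟩ : ∃ v w, m = ![v, w] := ⟨m 0, m 1, by funext i; fin_cases i <;> rfl⟩
  have hs : (extChartAt model6 c).symm y = ((extChartAt (𝓡 4) c.1).symm y.1,
      (extChartAt (𝓡 1) c.2.1).symm y.2.1, (extChartAt 𝓘(ℝ, ℝ) c.2.2).symm y.2.2) := by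
    rw [extChartAt_prod, extChartAt_prod]; rfl
  have hl : chartForm (prodForm η) c y ![v, w] = prodForm η ((extChartAt model6 c).symm y)
      ![mfderiv 𝓘(ℝ, EuclideanSpace ℝ (Fin 4) × EuclideanSpace ℝ (Fin 1) × ℝ) model6
          (extChartAt model6 c).symm y v,
        mfderiv 𝓘(ℝ, EuclideanSpace ℝ (Fin 4) × EuclideanSpace ℝ (Fin 1) × ℝ) model6
          (extChartAt model6 c).symm y w] :=
    congrArg (prodForm η ((extChartAt model6 c).symm y)) (matrix_fin_two_comp _ v w)
  rw [hl, mfderiv_extChartAt_symm_model6 c hy, mfderiv_extChartAt_symm_model6 c hy]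
  refine (prodForm_apply η _ _ _).trans ?_
  rw [hs]
  dsimp only
  rw [dθ_mfderiv_extChartAt_symm _ hy'.2.1, dθ_mfderiv_extChartAt_symm _ hy'.2.1]
  rw [ContinuousAlternatingMap.add_apply,
    ContinuousAlternatingMap.compContinuousLinearMap_apply,
    ContinuousAlternatingMap.compContinuousLinearMap_apply, matrix_fin_two_comp,
    matrix_fin_two_comp, cylinderForm_apply]
  refine congrArg₂ (· + ·) ?_ ?_
  · exact (congrArg (η ((extChartAt (𝓡 4) c.1).symm y.1)) (matrix_fin_two_comp _ _ _)).symm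
  · simp only [ContinuousLinearMap.coe_snd']
    ring

theorem IsSymplecticForm.prodForm {η : TwoForm (𝓡 4) Y} (hη : IsSymplecticForm η) :
    IsSymplecticForm (prodForm η) where
  smooth c := by
    refine ContDiffOn.congr (ContDiffOn.add ?_ ?_) (chartForm_prodForm η c)
    · refine (hη.smooth c.1).linear_pullback _ fun y hy => ?_
      rw [extChartAt_prod] at hy
      exact hy.1
    · refine (contDiffOn_cylinderForm c.2.1).linear_pullback _ fun y hy => ?_
      rw [extChartAt_prod, extChartAt_prod] at hy
      exact ⟨hy.2.1, trivial⟩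
  closed c y hy := by
    have hy' := hy
    rw [extChartAt_prod, extChartAt_prod] at hy'
    have d1 : DifferentiableAt ℝ (chartForm η c.1) y.1 :=
      ((hη.smooth c.1).contDiffAt ((isOpen_extChartAt_target c.1).mem_nhds hy'.1)).differentiableAt
        (by simp)
    have d2 : DifferentiableAt ℝ (cylinderForm c.2.1) y.2 :=
      ((contDiffOn_cylinderForm c.2.1).contDiffAt
        (((isOpen_extChartAt_target c.2.1).prod isOpen_univ).mem_nhds
          ⟨hy'.2.1, trivial⟩)).differentiableAt (by simp)
    rw [((chartForm_prodForm η c).eventuallyEq_of_mem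
      ((isOpen_extChartAt_target c).mem_nhds hy)).extDeriv_eq]
    rw [extDeriv_fun_add]
    · rw [extDeriv_linear_pullback _ d1, extDeriv_linear_pullback _ d2,
        extDeriv_eq_zero_of_finrank_le (by simp) (cylinderForm c.2.1)]
      have h0 := hη.closed c.1 y.1 hy'.1
      rw [ContinuousLinearMap.coe_fst', h0]
      ext v
      simp
    · exact (ContinuousAlternatingMap.compContinuousLinearMapCLM (𝕜 := ℝ) (F := ℝ) (ι := Fin 2)
        (ContinuousLinearMap.fst ℝ (EuclideanSpace ℝ (Fin 4))
          (EuclideanSpace ℝ (Fin 1) × ℝ))).differentiableAt.comp y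
            (d1.comp y differentiableAt_fst)
    · exact (ContinuousAlternatingMap.compContinuousLinearMapCLM (𝕜 := ℝ) (F := ℝ) (ι := Fin 2)
        (ContinuousLinearMap.snd ℝ (EuclideanSpace ℝ (Fin 4))
          (EuclideanSpace ℝ (Fin 1) × ℝ))).differentiableAt.comp y
            (d2.comp y differentiableAt_snd)
  nondegenerate x v h := by
    obtain ⟨v1, v2, v3⟩ : EuclideanSpace ℝ (Fin 4) × EuclideanSpace ℝ (Fin 1) × ℝ := v
    have h' : ∀ w : EuclideanSpace ℝ (Fin 4) × EuclideanSpace ℝ (Fin 1) × ℝ,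
        η x.1 ![v1, w.1] + (v3 * dθ x.2.1 w.2.1 - w.2.2 * dθ x.2.1 v2) = 0 :=
      fun w => (prodForm_apply η x (v1, v2, v3) w).symm.trans (h w)
    have z1 : ∀ w, η x.1 ![v1, w] = 0 := fun w => by
      have := h' (w, 0, 0)
      have hz : dθ x.2.1 (0 : EuclideanSpace ℝ (Fin 1)) = 0 := map_zero (dθ x.2.1)
      simpa [hz] using this
    have e0 : η x.1 ![v1, (0 : EuclideanSpace ℝ (Fin 4))] = 0 := z1 0
    -- The circle direction is paired only with `dr`, so it detects the `r`-component; `∂/∂r` then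
    -- detects the circle component.
    have z3 : v3 = 0 := by
      obtain ⟨u, hu⟩ := exists_dθ_ne_zero x.2.1
      have := h' (0, u, 0)
      simp only [e0, zero_mul, sub_zero, zero_add] at this
      exact (mul_eq_zero.1 this).resolve_right hu
    have z2 : v2 = 0 := by
      have := h' (0, 0, 1)
      simp only [e0, z3, zero_mul, zero_add, one_mul, zero_sub, neg_eq_zero] at this
      exact dθ_injective x.2.1 (this.trans (map_zero (dθ x.2.1)).symm)
    have z1' : v1 = 0 := hη.nondegenerate x.1 v1 z1
    rw [z1', z2, z3]
    rfl

end

/-! ### The product fibration -/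

instance : ConnectedSpace unitIoo :=
  Subtype.connectedSpace (isConnected_Ioo (by norm_num : (0 : ℝ) < 1))

theorem prodMap_preimage_singleton {Y D : Type*} (g : Y → D) (b : D × unitIoo) :
    prodMap g ⁻¹' {b} = (g ⁻¹' {b.1}) ×ˢ ((univ : Set Circle) ×ˢ {b.2}) := by
  ext x
  simp [prodMap, Prod.ext_iff]

theorem isProperMap_prodMap {Y D : Type*} [TopologicalSpace Y] [TopologicalSpace D] {g : Y → D}
    (hg : IsProperMap g) : IsProperMap (prodMap g) := by
  have : IsProperMap (Prod.snd : Circle × unitIoo → unitIoo) := isProperMap_snd_of_compactSpace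
  exact hg.prodMap this

section

variable {Y : Type*} [TopologicalSpace Y] [ChartedSpace (EuclideanSpace ℝ (Fin 4)) Y]
  {ρ : ℝ} {g : Y → disc ρ}

theorem contMDiff_prodMap (hg : ContMDiff (𝓡 4) 𝓘(ℝ, ℂ) ∞ g) :
    ContMDiff model6 model3 ∞ (prodMap g) :=
  (hg.comp contMDiff_fst).prodMk (contMDiff_snd.comp contMDiff_snd)

theorem mfderiv_prodMap_apply (hg : ContMDiff (𝓡 4) 𝓘(ℝ, ℂ) ∞ g) (x : Y × Circle × unitIoo)
    (v : EuclideanSpace ℝ (Fin 4) × EuclideanSpace ℝ (Fin 1) × ℝ) :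
    mfderiv model6 model3 (prodMap g) x v = (mfderiv (𝓡 4) 𝓘(ℝ, ℂ) g x.1 v.1, v.2.2) := by
  have hd := (hg.mdifferentiableAt (x := x.1) (by simp)).hasMFDerivAt
  have h1 := hd.comp x (hasMFDerivAt_fst (I := 𝓡 4) (I' := (𝓡 1).prod 𝓘(ℝ, ℝ)) x)
  have h2 := (hasMFDerivAt_snd (I := 𝓡 1) (I' := 𝓘(ℝ, ℝ)) x.2).comp x
    (hasMFDerivAt_snd (I := 𝓡 4) (I' := (𝓡 1).prod 𝓘(ℝ, ℝ)) x)
  exact DFunLike.congr_fun (h1.prodMk h2).mfderiv v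

/-- The `r`-component of the target is always attained, so surjectivity of `df` is surjectivity of
`dg`. -/
theorem crit_prodMap (hg : ContMDiff (𝓡 4) 𝓘(ℝ, ℂ) ∞ g) :
    Crit model6 model3 (prodMap g) = Prod.fst ⁻¹' Crit (𝓡 4) 𝓘(ℝ, ℂ) g := by
  ext x
  refine not_congr ⟨fun h a => ?_, fun h a => ?_⟩
  · obtain ⟨v, hv⟩ := h ((a, 0) : ℂ × ℝ)
    exact ⟨_, congrArg (Prod.fst : ℂ × ℝ → ℂ) ((mfderiv_prodMap_apply hg x v).symm.trans hv)⟩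
  · obtain ⟨a1, a2⟩ : ℂ × ℝ := a
    obtain ⟨v, hv⟩ := h a1
    refine ⟨((v, 0, a2) : EuclideanSpace ℝ (Fin 4) × EuclideanSpace ℝ (Fin 1) × ℝ), ?_⟩
    rw [mfderiv_prodMap_apply hg]
    exact congrArg (fun c : ℂ => ((c, a2) : ℂ × ℝ)) hv

theorem IsLagrangianFibration.prodMap [IsManifold (𝓡 4) ∞ Y] {η : TwoForm (𝓡 4) Y}
    (h : IsLagrangianFibration 𝓘(ℝ, ℂ) η g) :
    IsLagrangianFibration model3 (prodForm η) (prodMap g) where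
  finrank_pos := by simp
  finrank_eq := by simp
  connected_total := by
    have := h.connected_total
    infer_instance
  connected_base := by
    have := h.connected_base
    infer_instance
  symplectic := h.symplectic.prodForm
  smooth := contMDiff_prodMap h.smooth
  proper := isProperMap_prodMap h.proper
  connected_fibre b := by
    rw [prodMap_preimage_singleton]
    exact (h.connected_fibre b.1).prod (isConnected_univ.prod isConnected_singleton)
  lagrangian x hx v := by
    have hx1 : x.1 ∉ Crit (𝓡 4) 𝓘(ℝ, ℂ) g := by
      rw [crit_prodMap h.smooth] at hx
      exact hx
    have hl := h.lagrangian x.1 hx1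
    obtain ⟨v1, v2, v3⟩ : EuclideanSpace ℝ (Fin 4) × EuclideanSpace ℝ (Fin 1) × ℝ := v
    have hker : ∀ w : EuclideanSpace ℝ (Fin 4) × EuclideanSpace ℝ (Fin 1) × ℝ,
        mfderiv model6 model3 (_root_.prodMap g) x w = 0 ↔
          mfderiv (𝓡 4) 𝓘(ℝ, ℂ) g x.1 w.1 = 0 ∧ w.2.2 = 0 := fun w => by
      rw [mfderiv_prodMap_apply h.smooth]
      exact Prod.mk_eq_zero (M := ℂ) (N := ℝ)
    have hform : ∀ w : EuclideanSpace ℝ (Fin 4) × EuclideanSpace ℝ (Fin 1) × ℝ,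
        _root_.prodForm η x ![(v1, v2, v3), w] =
          η x.1 ![v1, w.1] + (v3 * dθ x.2.1 w.2.1 - w.2.2 * dθ x.2.1 v2) :=
      prodForm_apply η x (v1, v2, v3)
    constructor
    · intro hv w hw
      obtain ⟨hv1, hv3⟩ := (hker _).1 hv
      obtain ⟨hw1, hw3⟩ := (hker w).1 hw
      refine (hform w).trans ?_
      rw [(hl v1).1 hv1 _ hw1, hw3, show v3 = 0 from hv3]
      ring
    · intro hv
      have hv' : ∀ w : EuclideanSpace ℝ (Fin 4) × EuclideanSpace ℝ (Fin 1) × ℝ,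
          mfderiv (𝓡 4) 𝓘(ℝ, ℂ) g x.1 w.1 = 0 → w.2.2 = 0 →
            η x.1 ![v1, w.1] + (v3 * dθ x.2.1 w.2.1 - w.2.2 * dθ x.2.1 v2) = 0 :=
        fun w h1 h2 => (hform w).symm.trans (hv w ((hker w).2 ⟨h1, h2⟩))
      have z1 : ∀ w : EuclideanSpace ℝ (Fin 4), mfderiv (𝓡 4) 𝓘(ℝ, ℂ) g x.1 w = 0 →
          η x.1 ![v1, w] = 0 := fun w hw => by
        have := hv' (w, 0, 0) hw rfl
        have hz : dθ x.2.1 (0 : EuclideanSpace ℝ (Fin 1)) = 0 := map_zero (dθ x.2.1)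
        simpa [hz] using this
      have hd0 : mfderiv (𝓡 4) 𝓘(ℝ, ℂ) g x.1 (0 : EuclideanSpace ℝ (Fin 4)) = 0 :=
        map_zero (mfderiv (𝓡 4) 𝓘(ℝ, ℂ) g x.1)
      refine (hker _).2 ⟨(hl v1).2 z1, ?_⟩
      -- The vector `(0, u, 0)` lies in `ker df`, and pairing with it gives `v3 * dθ u = 0`.
      obtain ⟨u, hu⟩ := exists_dθ_ne_zero x.2.1
      have := hv' (0, u, 0) hd0 rfl
      simp only [z1 0 hd0, zero_mul, sub_zero, zero_add] at this
      exact (mul_eq_zero.1 this).resolve_right hu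

theorem image_crit_prodMap (hg : ContMDiff (𝓡 4) 𝓘(ℝ, ℂ) ∞ g) {x₀ : Y}
    (hx₀ : Crit (𝓡 4) 𝓘(ℝ, ℂ) g = {x₀}) (h0 : (g x₀ : ℂ) = 0) :
    prodMap g '' Crit model6 model3 (prodMap g) = {b | (b.1 : ℂ) = 0} := by
  rw [crit_prodMap hg, hx₀]
  ext b
  constructor
  · rintro ⟨x, hx, rfl⟩
    have hx' : x.1 = x₀ := hx
    simpa [prodMap, hx'] using h0
  · intro hb
    exact ⟨(x₀, 1, b.2), rfl, Prod.ext (Subtype.ext (h0.trans (Eq.symm hb))) rfl⟩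

/-! ### Admissibility -/

/-- The preferred chart of an open subset of a vector space is the inclusion, defined everywhere.
The image is therefore independent of `c`, and the supremum in `HasCodimTwo` is over a constant
family. -/
theorem image_extChartAt_model3 (c : disc ρ × unitIoo) (S : Set (disc ρ × unitIoo)) :
    extChartAt model3 c '' (S ∩ (extChartAt model3 c).source) =
      (fun b : disc ρ × unitIoo => ((b.1 : ℂ), (b.2 : ℝ))) '' S := by
  have hs : (extChartAt model3 c).source = univ := by
    rw [extChartAt_prod]
    simp only [PartialEquiv.prod_source, extChartAt_source, TopologicalSpace.Opens.chartAt_eq,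
      OpenPartialHomeomorph.subtypeRestr_source]
    exact eq_univ_of_forall fun _ => ⟨trivial, trivial⟩
  rw [hs, inter_univ]
  rfl

/-- In the chart this set is an isometric copy of `(0, 1)`, of Hausdorff dimension one, and `1 + 2 =
3`. -/
theorem hasCodimTwo_zero_section (hρ : 0 < ρ) :
    HasCodimTwo model3 {b : disc ρ × unitIoo | (b.1 : ℂ) = 0} := by
  have himg : (fun b : disc ρ × unitIoo => ((b.1 : ℂ), (b.2 : ℝ))) '' {b | (b.1 : ℂ) = 0} =
      (fun t : ℝ => ((0 : ℂ), t)) '' Ioo 0 1 := by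
    ext p
    constructor
    · rintro ⟨b, hb, rfl⟩
      exact ⟨b.2, b.2.2, Prod.ext (Eq.symm hb) rfl⟩
    · rintro ⟨t, ht, rfl⟩
      exact ⟨(⟨0, Metric.mem_ball_self hρ⟩, ⟨t, ht⟩), rfl, rfl⟩
  have hiso : Isometry (fun t : ℝ => ((0 : ℂ), t)) := by
    intro s t
    simp [Prod.edist_eq]
  have hdim : dimH (Ioo (0 : ℝ) 1) = 1 := by
    rw [Real.dimH_of_mem_nhds (x := 1 / 2) (Ioo_mem_nhds (by norm_num) (by norm_num))]
    simp
  -- `ciSup_const` needs a nonempty index set.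
  have : Nonempty (disc ρ × unitIoo) :=
    ⟨(⟨0, Metric.mem_ball_self hρ⟩, ⟨1 / 2, by norm_num, by norm_num⟩)⟩
  unfold HasCodimTwo
  simp only [image_extChartAt_model3, himg, hiso.dimH_image, hdim, ciSup_const]
  simp
  norm_num

theorem IsAdmissible.prodMap (hρ : 0 < ρ) (hg : ContMDiff (𝓡 4) 𝓘(ℝ, ℂ) ∞ g)
    (h : IsAdmissible (𝓡 4) 𝓘(ℝ, ℂ) g) {x₀ : Y}
    (hx₀ : Crit (𝓡 4) 𝓘(ℝ, ℂ) g = {x₀}) (h0 : (g x₀ : ℂ) = 0) :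
    IsAdmissible model6 model3 (prodMap g) where
  crit_connected b := by
    have : Crit model6 model3 (_root_.prodMap g) ∩ _root_.prodMap g ⁻¹' {b} =
        (Crit (𝓡 4) 𝓘(ℝ, ℂ) g ∩ g ⁻¹' {b.1}) ×ˢ ((univ : Set Circle) ×ˢ {b.2}) := by
      rw [crit_prodMap hg, prodMap_preimage_singleton]
      ext x
      simp [and_assoc]
    rw [this]
    exact (h.crit_connected b.1).prod (isPreconnected_univ.prod isPreconnected_singleton)
  regular_connected b := by
    have : (Crit model6 model3 (_root_.prodMap g))ᶜ ∩ _root_.prodMap g ⁻¹' {b} =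
        ((Crit (𝓡 4) 𝓘(ℝ, ℂ) g)ᶜ ∩ g ⁻¹' {b.1}) ×ˢ ((univ : Set Circle) ×ˢ {b.2}) := by
      rw [crit_prodMap hg, prodMap_preimage_singleton]
      ext x
      simp [and_assoc]
    rw [this]
    exact (h.regular_connected b.1).prod (isPreconnected_univ.prod isPreconnected_singleton)
  discriminant_closed := by
    rw [image_crit_prodMap hg hx₀ h0]
    exact isClosed_eq (continuous_subtype_val.comp continuous_fst) continuous_const
  discriminant_codim := by
    rw [image_crit_prodMap hg hx₀ h0]
    exact hasCodimTwo_zero_section hρ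
  regular_surjective := by
    refine eq_univ_of_forall fun b => ?_
    obtain ⟨x, hx, hb⟩ : b.1 ∈ g '' (Crit (𝓡 4) 𝓘(ℝ, ℂ) g)ᶜ := by
      rw [h.regular_surjective]; trivial
    refine ⟨(x, 1, b.2), ?_, Prod.ext hb rfl⟩
    rw [crit_prodMap hg]
    exact hx
  exists_section x hx := by
    rw [crit_prodMap hg] at hx
    obtain ⟨W, σ, hW, hxW, hσ, hsec, hσx⟩ := h.exists_section x.1 hx
    refine ⟨W ×ˢ univ, fun b => (σ b.1, x.2.1, b.2), hW.prod isOpen_univ, ⟨hxW, trivial⟩, ?_,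
      fun b hb => Prod.ext (hsec b.1 hb.1) rfl, ?_⟩
    · exact (hσ.comp contMDiffOn_fst fun b hb => hb.1).prodMk
        (contMDiffOn_const.prodMk contMDiffOn_snd)
    · exact Prod.ext hσx rfl

end

/-! ### Diffeomorphisms between subsets -/

section

variable {E : Type*} [NormedAddCommGroup E] [NormedSpace ℝ E] {H : Type*} [TopologicalSpace H]
  {I : ModelWithCorners ℝ E H} {M : Type*} [TopologicalSpace M] [ChartedSpace H M]
  {E' : Type*} [NormedAddCommGroup E'] [NormedSpace ℝ E'] {H' : Type*} [TopologicalSpace H']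
  {I' : ModelWithCorners ℝ E' H'} {M' : Type*} [TopologicalSpace M'] [ChartedSpace H' M']
  {E'' : Type*} [NormedAddCommGroup E''] [NormedSpace ℝ E''] {H'' : Type*} [TopologicalSpace H'']
  {I'' : ModelWithCorners ℝ E'' H''} {M'' : Type*} [TopologicalSpace M''] [ChartedSpace H'' M'']

theorem IsSmoothBetween.comp {A : Set M} {B : Set M'} {C : Set M''} {g : B → C} {f : A → B}
    (hg : IsSmoothBetween I' I'' g) (hf : IsSmoothBetween I I' f) :
    IsSmoothBetween I I'' (g ∘ f) := by
  intro a
  obtain ⟨U, hU, haU, f', hf', hfe⟩ := hf a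
  obtain ⟨V, hV, haV, g', hg', hge⟩ := hg (f a)
  -- The extension `f'` may leave `V` away from `A`, so its domain is cut down; the result is open
  -- because `f'` is continuous on `U`.
  refine ⟨U ∩ f' ⁻¹' V, hf'.continuousOn.isOpen_inter_preimage hU hV, ⟨haU, ?_⟩, g' ∘ f',
    hg'.comp (hf'.mono inter_subset_left) inter_subset_right, fun x hx => ?_⟩
  · rw [mem_preimage, hfe a haU]
    exact haV
  · have h2 : f' x ∈ V := hx.2
    rw [hfe x hx.1] at h2
    rw [Function.comp_apply, hfe x hx.1, hge _ h2, Function.comp_apply]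

theorem AreDiffeomorphic.trans {A : Set M} {B : Set M'} {C : Set M''}
    (h : AreDiffeomorphic I I' A B) (h' : AreDiffeomorphic I' I'' B C) :
    AreDiffeomorphic I I'' A C := by
  obtain ⟨e, he, hes⟩ := h
  obtain ⟨e', he', hes'⟩ := h'
  exact ⟨e.trans e', he'.comp he, hes.comp hes'⟩

theorem AreDiffeomorphic.of_global (e : M ≃ M') (he : ContMDiff I I' ∞ e)
    (hes : ContMDiff I' I ∞ e.symm) {A : Set M} {B : Set M'} (hAB : ∀ x, x ∈ A ↔ e x ∈ B) :
    AreDiffeomorphic I I' A B :=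
  ⟨e.subtypeEquiv hAB,
    fun _ => ⟨univ, isOpen_univ, trivial, e, he.contMDiffOn, fun _ _ => rfl⟩,
    fun _ => ⟨univ, isOpen_univ, trivial, e.symm, hes.contMDiffOn, fun _ _ => rfl⟩⟩

/-- Local extensions on the first factor are multiplied by the identity of the circle; the last
coordinate is forgotten in one direction and set to the constant `r` in the other. -/
theorem AreDiffeomorphic.prod_univ_singleton {A : Set M} {B : Set M'}
    (h : AreDiffeomorphic I I' A B) (r : M'') :
    AreDiffeomorphic (I.prod ((𝓡 1).prod I'')) (I'.prod (𝓡 1))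
      (A ×ˢ ((univ : Set Circle) ×ˢ {r})) (B ×ˢ (univ : Set Circle)) := by
  obtain ⟨e, he, hes⟩ := h
  refine ⟨⟨fun p => ⟨(e ⟨p.1.1, p.2.1⟩, p.1.2.1), (e ⟨p.1.1, p.2.1⟩).2, trivial⟩,
    fun q => ⟨(e.symm ⟨q.1.1, q.2.1⟩, q.1.2, r), (e.symm ⟨q.1.1, q.2.1⟩).2, trivial, rfl⟩,
    ?_, ?_⟩, ?_, ?_⟩
  · rintro ⟨⟨a, z, s⟩, ha, -, hs⟩
    obtain rfl : s = r := hs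
    simp
  · rintro ⟨⟨b, z⟩, hb, -⟩
    simp
  · intro a
    obtain ⟨U, hU, haU, f', hf', hfe⟩ := he ⟨a.1.1, a.2.1⟩
    exact ⟨U ×ˢ univ, hU.prod isOpen_univ, ⟨haU, trivial⟩, fun x => (f' x.1, x.2.1),
      (hf'.comp contMDiffOn_fst fun x hx => hx.1).prodMk
        (contMDiff_fst.comp contMDiff_snd).contMDiffOn,
      fun x hx => Prod.ext (hfe ⟨x.1.1, x.2.1⟩ hx.1) rfl⟩
  · intro b
    obtain ⟨U, hU, hbU, f', hf', hfe⟩ := hes ⟨b.1.1, b.2.1⟩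
    exact ⟨U ×ˢ univ, hU.prod isOpen_univ, ⟨hbU, trivial⟩, fun x => (f' x.1, x.2, r),
      (hf'.comp contMDiffOn_fst fun x hx => hx.1).prodMk
        (contMDiffOn_snd.prodMk contMDiffOn_const),
      fun x hx => Prod.ext (hfe ⟨x.1.1, x.2.1⟩ hx.1) rfl⟩

theorem AreDiffeomorphic.torus_prod_circle {A : Set M}
    (h : AreDiffeomorphic I ((𝓡 1).prod (𝓡 1)) A (univ : Set (Circle × Circle))) (r : M'') :
    AreDiffeomorphic (I.prod ((𝓡 1).prod I'')) ((𝓡 1).prod ((𝓡 1).prod (𝓡 1)))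
      (A ×ˢ ((univ : Set Circle) ×ˢ {r})) (univ : Set (Circle × Circle × Circle)) :=
  (h.prod_univ_singleton r).trans <|
    AreDiffeomorphic.of_global (Equiv.prodAssoc Circle Circle Circle)
      ((contMDiff_fst.comp contMDiff_fst).prodMk
        ((contMDiff_snd.comp contMDiff_fst).prodMk contMDiff_snd))
      ((contMDiff_fst.prodMk (contMDiff_fst.comp contMDiff_snd)).prodMk
        (contMDiff_snd.comp contMDiff_snd))
      (by simp)

/-! ### Restrictions and products of symplectomorphisms -/

theorem IsDiffeoOn.mono {e e' : OpenPartialHomeomorph M M'} (h : IsDiffeoOn I I' e)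
    (hs : e'.source ⊆ e.source) (ht : e'.target ⊆ e.target) (hc : (e' : M → M') = e)
    (hcs : (e'.symm : M' → M) = e.symm) : IsDiffeoOn I I' e' := by
  refine ⟨?_, ?_⟩
  · rw [hc]; exact h.1.mono hs
  · rw [hcs]; exact h.2.mono ht

theorem IsDiffeoOn.prod_refl {e : OpenPartialHomeomorph M M'} (h : IsDiffeoOn I I' e) :
    IsDiffeoOn (I.prod I'') (I'.prod I'') (e.prod (OpenPartialHomeomorph.refl M'')) :=
  ⟨h.1.prodMap contMDiffOn_id, h.2.prodMap contMDiffOn_id⟩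

theorem IsSymplectoOn.mono {η : TwoForm I M} {ζ : TwoForm I' M'}
    {e e' : OpenPartialHomeomorph M M'} (h : IsSymplectoOn η ζ e)
    (hs : e'.source ⊆ e.source) (ht : e'.target ⊆ e.target) (hc : (e' : M → M') = e)
    (hcs : (e'.symm : M' → M) = e.symm) : IsSymplectoOn η ζ e' := by
  refine ⟨h.1.mono hs ht hc hcs, fun x hx => ?_⟩
  rw [hc]
  exact h.2 x (hs hx)

end

/-- The differential of the product map is `de` plus the identity, so the `dr ∧ dθ` terms agree and
the remaining terms agree by hypothesis. -/
theorem IsSymplectoOn.prod_refl {Y Z : Type*} [TopologicalSpace Y]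
    [ChartedSpace (EuclideanSpace ℝ (Fin 4)) Y] [TopologicalSpace Z]
    [ChartedSpace (EuclideanSpace ℝ (Fin 4)) Z] {η : TwoForm (𝓡 4) Y} {ζ : TwoForm (𝓡 4) Z}
    {e : OpenPartialHomeomorph Y Z} (h : IsSymplectoOn η ζ e) :
    IsSymplectoOn (prodForm η) (prodForm ζ)
      (e.prod (OpenPartialHomeomorph.refl (Circle × unitIoo))) := by
  refine ⟨h.1.prod_refl, fun x hx => ?_⟩
  have hx1 : x.1 ∈ e.source := hx.1
  have hd : MDifferentiableAt (𝓡 4) (𝓡 4) e x.1 :=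
    (h.1.1.contMDiffAt (e.open_source.mem_nhds hx1)).mdifferentiableAt (by simp)
  have hm : ∀ v : EuclideanSpace ℝ (Fin 4) × EuclideanSpace ℝ (Fin 1) × ℝ,
      mfderiv model6 model6 (e.prod (OpenPartialHomeomorph.refl (Circle × unitIoo))) x v =
        (mfderiv (𝓡 4) (𝓡 4) e x.1 v.1, v.2) := fun v =>
    DFunLike.congr_fun ((hd.hasMFDerivAt.comp x
      (hasMFDerivAt_fst (I' := (𝓡 1).prod 𝓘(ℝ, ℝ)) x)).prodMk
      (hasMFDerivAt_snd (I := 𝓡 4) (I' := (𝓡 1).prod 𝓘(ℝ, ℝ)) x)).mfderiv v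
  ext m
  obtain ⟨v, w, rfl⟩ : ∃ v w : EuclideanSpace ℝ (Fin 4) × EuclideanSpace ℝ (Fin 1) × ℝ,
    m = ![v, w] := ⟨m 0, m 1, by funext i; fin_cases i <;> rfl⟩
  have hr : prodForm ζ (e.prod (OpenPartialHomeomorph.refl (Circle × unitIoo)) x)
      ![mfderiv model6 model6 (e.prod (OpenPartialHomeomorph.refl (Circle × unitIoo))) x v,
        mfderiv model6 model6 (e.prod (OpenPartialHomeomorph.refl (Circle × unitIoo))) x w] =
      ζ (e x.1) ![mfderiv (𝓡 4) (𝓡 4) e x.1 v.1, mfderiv (𝓡 4) (𝓡 4) e x.1 w.1] +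
        (v.2.2 * dθ x.2.1 w.2.1 - w.2.2 * dθ x.2.1 v.2.1) := by
    rw [hm, hm]
    exact prodForm_apply ζ _ _ _
  have hη : η x.1 ![v.1, w.1] =
      ζ (e x.1) ![mfderiv (𝓡 4) (𝓡 4) e x.1 v.1, mfderiv (𝓡 4) (𝓡 4) e x.1 w.1] := by
    rw [h.2 x.1 hx1]
    exact congrArg (ζ (e x.1)) (matrix_fin_two_comp _ _ _)
  refine ((prodForm_apply η x v w).trans ?_).trans
    (hr.symm.trans (congrArg (prodForm ζ _) (matrix_fin_two_comp _ v w).symm))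
  rw [hη]

/-! ### The focus-focus normal form -/

/-- This is multiplicativity of the modulus for `q = z̄₁ z₂`. -/
theorem normSq_focusFocus (v : EuclideanSpace ℝ (Fin 4)) :
    ‖focusFocus v‖ ^ 2 = (v 0 ^ 2 + v 1 ^ 2) * (v 2 ^ 2 + v 3 ^ 2) := by
  rw [← Complex.normSq_eq_norm_sq, Complex.normSq_apply, focusFocus]
  ring

theorem focusFocus_image_ball {R : ℝ} (hR : 0 < R) :
    focusFocus '' Metric.ball 0 R = Metric.ball 0 (R ^ 2 / 2) := by
  ext c
  rw [mem_ball_zero_iff]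
  constructor
  · rintro ⟨v, hv, rfl⟩
    rw [mem_ball_zero_iff] at hv
    have h1 := normSq_focusFocus v
    have h2 : ‖v‖ ^ 2 = v 0 ^ 2 + v 1 ^ 2 + v 2 ^ 2 + v 3 ^ 2 := by
      rw [EuclideanSpace.real_norm_sq_eq, Fin.sum_univ_four]
    have h3 : ‖v‖ ^ 2 < R ^ 2 := by gcongr
    -- The inequality of arithmetic and geometric means for `|z₁|²` and `|z₂|²`.
    have h4 : ‖focusFocus v‖ ≤ ‖v‖ ^ 2 / 2 := by
      rw [← sq_le_sq₀ (norm_nonneg _) (by positivity)]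
      rw [h1, h2]
      nlinarith [sq_nonneg (v 0 ^ 2 + v 1 ^ 2 - (v 2 ^ 2 + v 3 ^ 2))]
    linarith
  · intro hc
    rcases eq_or_ne c 0 with rfl | h0
    · exact ⟨0, by simpa using hR, by simp [focusFocus, Complex.ext_iff]⟩
    · have hpos : 0 < ‖c‖ := norm_pos_iff.2 h0
      have hs : 0 < √‖c‖ := Real.sqrt_pos.2 hpos
      -- Equality case: `z₁ = √|c|` and `z₂ = c / √|c|` have equal moduli, so the squared norm is
      -- exactly `2 |c| < R²`.
      refine ⟨!₂[√‖c‖, 0, c.re / √‖c‖, c.im / √‖c‖], ?_, ?_⟩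
      · rw [mem_ball_zero_iff]
        refine lt_of_pow_lt_pow_left₀ 2 hR.le ?_
        rw [EuclideanSpace.real_norm_sq_eq, Fin.sum_univ_four]
        have h5 : c.re ^ 2 + c.im ^ 2 = ‖c‖ ^ 2 := by
          rw [← Complex.normSq_eq_norm_sq, Complex.normSq_apply]; ring
        have h6 : (c.re / √‖c‖) ^ 2 + (c.im / √‖c‖) ^ 2 = ‖c‖ := by
          rw [div_pow, div_pow, Real.sq_sqrt hpos.le, ← add_div, h5]
          field_simp
        have h7 := Real.sq_sqrt hpos.le
        simp
        nlinarith
      · apply Complex.ext <;> simp [focusFocus] <;> field_simp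

theorem OpenPartialHomeomorph.exists_restr_target {X Z : Type*} [TopologicalSpace X]
    [TopologicalSpace Z] (e : OpenPartialHomeomorph X Z) {T : Set Z} (hT : IsOpen T)
    (hTe : T ⊆ e.target) :
    ∃ e' : OpenPartialHomeomorph X Z, e'.source = e.source ∩ e ⁻¹' T ∧ e'.target = T ∧
      (e' : X → Z) = e ∧ (e'.symm : Z → X) = e.symm := by
  refine ⟨(e.symm.restrOpen T hT).symm, ?_, ?_, rfl, rfl⟩
  · simp
  · simpa using hTe

/-! ### Type `(2, 2)` over a neighbourhood of the singular value -/

section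

variable {Y : Type*} [TopologicalSpace Y] [ChartedSpace (EuclideanSpace ℝ (Fin 4)) Y]
  {ρ : ℝ} {η : TwoForm (𝓡 4) Y} {g : Y → disc ρ}

theorem IsFocusFocusFibration.regular_fibre_prodMap (hg : IsFocusFocusFibration η g)
    (b : disc ρ × unitIoo) (hb : (b.1 : ℂ) ≠ 0) :
    AreDiffeomorphic model6 ((𝓡 1).prod ((𝓡 1).prod (𝓡 1))) (prodMap g ⁻¹' {b})
      (univ : Set (Circle × Circle × Circle)) := by
  rw [prodMap_preimage_singleton]
  exact (hg.regular_fibre b.1 hb).torus_prod_circle b.2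

theorem IsFocusFocusFibration.exists_isTypeTwoTwoOver [IsManifold (𝓡 4) ∞ Y] (hρ : 0 < ρ)
    (hg : IsFocusFocusFibration η g) :
    ∃ D' : Set (disc ρ), IsOpen D' ∧ (∀ b : disc ρ, (b : ℂ) = 0 → b ∈ D') ∧
      IsTypeTwoTwoOver model3 (prodForm η) (prodMap g) (D' ×ˢ univ) := by
  obtain ⟨x₀, hcrit, h0, ψ, φ, hx₀, hψ0, hmaps, hψ, hφ, hcomm⟩ := hg.normal_form
  obtain ⟨R, hR, hRψ⟩ : ∃ R > 0, Metric.ball 0 R ⊆ ψ.target :=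
    Metric.isOpen_iff.1 ψ.open_target 0 (hψ0 ▸ ψ.map_source hx₀)
  -- No further shrinking of `R` is needed: the disc is the `q`-image of the ball, and `φ ∘ g = q ∘
  -- ψ` exhibits every such value as a value of `φ`.
  have hRφ : Metric.ball 0 (R ^ 2 / 2) ⊆ φ.target := by
    rw [← focusFocus_image_ball hR]
    rintro _ ⟨v, hv, rfl⟩
    have hs := ψ.map_target (hRψ hv)
    have := hcomm _ hs
    rw [ψ.right_inv (hRψ hv)] at this
    exact this ▸ φ.map_source (hmaps hs)
  obtain ⟨ψ', hψs, hψt, hψc, hψcs⟩ := ψ.exists_restr_target Metric.isOpen_ball hRψ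
  obtain ⟨φ', hφs, hφt, hφc, hφcs⟩ := φ.exists_restr_target Metric.isOpen_ball hRφ
  have hx₀' : x₀ ∈ ψ'.source := by
    rw [hψs]
    exact ⟨hx₀, by simpa [hψ0] using hR⟩
  -- The equality `f(U) = B'` comes from `q` mapping the ball onto the whole disc; for the reverse
  -- inclusion, injectivity of `φ` on its source turns equality of the `φ`-values into `g x = b`.
  have himage : g '' ψ'.source = φ'.source := by
    rw [hψs, hφs]
    ext b
    constructor
    · rintro ⟨x, ⟨hx, hxR⟩, rfl⟩
      refine ⟨hmaps hx, ?_⟩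
      rw [mem_preimage, hcomm x hx, ← focusFocus_image_ball hR]
      exact ⟨_, hxR, rfl⟩
    · rintro ⟨hb, hbR⟩
      rw [mem_preimage, ← focusFocus_image_ball hR] at hbR
      obtain ⟨v, hv, hvb⟩ := hbR
      have hs := ψ.map_target (hRψ hv)
      refine ⟨ψ.symm v, ⟨hs, ?_⟩, φ.injOn (hmaps hs) hb ?_⟩
      · rw [mem_preimage, ψ.right_inv (hRψ hv)]
        exact hv
      · rw [hcomm _ hs, ψ.right_inv (hRψ hv), hvb]
  refine ⟨φ'.source, φ'.open_source, fun b hb => ?_, hg.lagrangian.prodMap,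
    hg.admissible.prodMap hρ hg.lagrangian.smooth hcrit h0, fun b hb => ?_, R,
    ψ'.prod (.refl _), φ'.prod (.refl _), hR, ?_, ?_, ?_, ?_, ?_, ?_, ?_, ?_⟩
  · rw [← himage]
    exact ⟨x₀, hx₀', Subtype.ext (h0.trans hb.symm)⟩
  · rw [image_crit_prodMap hg.lagrangian.smooth hcrit h0] at hb
    exact hg.regular_fibre_prodMap b hb
  · rintro x ⟨hx, -⟩
    rw [crit_prodMap hg.lagrangian.smooth, hcrit] at hx
    have hx' : x.1 = x₀ := hx
    exact ⟨hx' ▸ hx₀', trivial⟩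
  · rw [← himage]
    ext b
    constructor
    · rintro ⟨x, hx, rfl⟩
      exact ⟨⟨x.1, hx.1, rfl⟩, trivial⟩
    · rintro ⟨⟨x, hx, hxb⟩, -⟩
      exact ⟨(x, 1, b.2), ⟨hx, trivial⟩, Prod.ext hxb rfl⟩
  · rfl
  · rw [← hψt]; rfl
  · rw [← hφt]; rfl
  · exact (hψ.mono (hψs ▸ inter_subset_left) (hψt ▸ hRψ) hψc hψcs).prod_refl
  · exact (hφ.mono (hφs ▸ inter_subset_left) (hφt ▸ hRφ) hφc hφcs).prod_refl
  · rintro x ⟨hx, -⟩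
    rw [hψs] at hx
    refine Prod.ext ?_ rfl
    change φ' (g x.1) = focusFocus (ψ' x.1)
    rw [hφc, hψc]
    exact hcomm x.1 hx.1

end

theorem mainTheorem10 {Y : Type*} [TopologicalSpace Y] [T2Space Y] [SecondCountableTopology Y]
    [ChartedSpace (EuclideanSpace ℝ (Fin 4)) Y] [IsManifold (𝓡 4) ∞ Y]
    (ρ : ℝ) (hρ : 0 < ρ) (η : TwoForm (𝓡 4) Y) (g : Y → disc ρ)
    (hg : IsFocusFocusFibration η g) :
    -- `η + dr ∧ dθ` is symplectic and `f = prodMap g` is a Lagrangian fibration over `D × (0, 1)`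
    IsSymplecticForm (prodForm η) ∧
    IsLagrangianFibration model3 (prodForm η) (prodMap g) ∧
    -- the discriminant locus is `{0} × (0, 1)`
    prodMap g '' Crit model6 model3 (prodMap g) = {b | (b.1 : ℂ) = 0} ∧
    -- the other fibres are three-tori
    (∀ b : disc ρ × unitIoo, (b.1 : ℂ) ≠ 0 →
      AreDiffeomorphic model6 ((𝓡 1).prod ((𝓡 1).prod (𝓡 1))) (prodMap g ⁻¹' {b})
        (univ : Set (Circle × Circle × Circle))) ∧
    -- the singular fibres are diffeomorphic to `I₁ × S¹`
    (∀ b : disc ρ × unitIoo, (b.1 : ℂ) = 0 →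
      AreDiffeomorphic model6 ((𝓡 4).prod (𝓡 1)) (prodMap g ⁻¹' {b})
        (pinchedTorus ×ˢ (univ : Set Circle))) ∧
    -- over a neighbourhood of `{0} × (0, 1)` the fibration belongs to `L(2, 2)`
    ∃ D' : Set (disc ρ), IsOpen D' ∧ (∀ b : disc ρ, (b : ℂ) = 0 → b ∈ D') ∧
      IsTypeTwoTwoOver model3 (prodForm η) (prodMap g) (D' ×ˢ univ) := by
  obtain ⟨x₀, hcrit, h0, -⟩ := hg.normal_form
  refine ⟨hg.lagrangian.symplectic.prodForm, hg.lagrangian.prodMap,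
    image_crit_prodMap hg.lagrangian.smooth hcrit h0, hg.regular_fibre_prodMap, fun b hb => ?_,
    hg.exists_isTypeTwoTwoOver hρ⟩
  rw [prodMap_preimage_singleton]
  exact (hg.singular_fibre b.1 hb).prod_univ_singleton b.2
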